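/- Let $n\ge 1$, let $0<\xi_1<\dots<\xi_{n-1}<\xi_n=1$ and $g_1,\dots,g_n>0$, and let $g=\sum_{i=1}^n g_i\delta_{\xi_i}$ (a discrete cubic string whose last mass is placed at the end point $1$). For $z\in\mathbb C$ let $\phi(\cdot\,;z)$ be the unique continuous function with $$-\phi_{\xi\xi\xi}=z\,g\,\phi \ \text{ in the sense of distributions},\qquad \phi(0;z)=\phi_\xi(0;z)=0,\quad \phi_{\xi\xi}(0;z)=1,$$ where the string is continued without mass beyond $[0,1]$; the values $\phi(1;z)$, $\phi_\xi(1;z)$, $\phi_{\xi\xi}(1;z)$ are understood as right-hand limits at $\xi=1$ (which exist). The spectrum of type 2 is the set of $z\in\mathbb C$ for which the boundary value problem $-\phi_{\xi\xi\xi}=zg\phi$, $\phi(0)=\phi_\xi(0)=0$, $\phi_{\xi\xi}(1)=0$ has a nonzero solution. It consists of $n$ distinct positive numbers $0<z_{2,1}<\dots<z_{2,n}$. Define the Weyl functions $W(z)=-\dfrac{\phi_\xi(1;z)}{\phi_{\xi\xi}(1;z)}$ and $Z(z)=-\dfrac{\phi(1;z)}{\phi_{\xi\xi}(1;z)}$.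 Then the numbers $$b_i=-\frac{\phi_\xi(1;z_{2,i})}{\phi_{\xi\xi z}(1;z_{2,i})},\qquad i=1,\dots,n,$$ are well defined (the derivatives $\phi_{\xi\xi z}(1;z_{2,i})=\partial_z\phi_{\xi\xi}(1;z)|_{z=z_{2,i}}$ exist and are nonzero), real and positive, and with $\beta=\sum_{i=1}^n b_i\,\delta_{z_{2,i}}$ one has, for every $z\in\mathbb C\setminus\{z_{2,1},\dots,z_{2,n}\}$, $\phi_{\xi\xi}(1;z)\neq 0$ and $$W(z)=\int\frac{1}{z-y}\,d\beta(y),\qquad Z(z)=\iint\frac{1}{(z-y)(x+y)}\,d\beta(x)\,d\beta(y).$$ -/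

import Mathlib

open MeasureTheory Filter Topology
open scoped ContDiff

namespace CubicString

/-- The discrete measure `∑ i, w i • δ_{p i}` on the line (used with positive weights). -/
noncomputable def pointMasses {n : ℕ} (w p : Fin n → ℝ) : Measure ℝ :=
  ∑ i, ENNReal.ofReal (w i) • Measure.dirac (p i)

/-- `φ` is a continuous solution of `-φ''' = z g φ` in the sense of distributions:
`∫ φ η''' dx = z ∫ φ η dg` for every test function `η`. The equation is posed on the whole line,
with no mass outside the support of `g`, so that right-hand limits at the end point `1` of the
string make sense and see a mass placed at `1`. -/
structure IsSolution (g : Measure ℝ) (z : ℂ) (φ : ℝ → ℂ) : Prop where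
  continuous : Continuous φ
  weak_eq : ∀ η : ℝ → ℝ, ContDiff ℝ ∞ η → HasCompactSupport η →
    ∫ x, iteratedDeriv 3 η x • φ x = z * ∫ x, η x • φ x ∂g

/-- The initial value problem `-φ''' = z g φ`, `φ(0) = φ'(0) = 0`, `φ''(0) = 1`. -/
structure IsIVPSolution (g : Measure ℝ) (z : ℂ) (φ : ℝ → ℂ) : Prop extends
    IsSolution g z φ where
  val_zero : φ 0 = 0
  deriv_zero : HasDerivAt φ 0 0
  deriv2_zero : HasDerivAt (deriv φ) 1 0

/-- `z` is an eigenvalue of the boundary value problem of type 2: there is a nonzero solution with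
`φ(0) = φ'(0) = 0` and `φ''(1) = 0`, the last value being the right-hand limit at `1`. -/
def IsEigenvalueType2 (g : Measure ℝ) (z : ℂ) : Prop :=
  ∃ φ : ℝ → ℂ, IsSolution g z φ ∧ φ ≠ 0 ∧ φ 0 = 0 ∧ HasDerivAt φ 0 0 ∧
    Tendsto (iteratedDeriv 2 φ) (𝓝[>] 1) (𝓝 0)

/-- The spectrum of the boundary value problem of type 2. -/
def spectrumType2 (g : Measure ℝ) : Set ℂ := {z | IsEigenvalueType2 g z}

/-- The right-hand limit at `1` of the `k`-th derivative of `φ`. -/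
noncomputable def endValue (k : ℕ) (φ : ℝ → ℂ) : ℂ := Function.rightLim (iteratedDeriv k φ) 1

/-- The Weyl function `W(z) = -φ_ξ(1; z) / φ_ξξ(1; z)` of type 2, for a family `φ z = φ(·; z)`. -/
noncomputable def weylW (φ : ℂ → ℝ → ℂ) (z : ℂ) : ℂ := -endValue 1 (φ z) / endValue 2 (φ z)

/-- The Weyl function `Z(z) = -φ(1; z) / φ_ξξ(1; z)` of type 2, for a family `φ z = φ(·; z)`. -/
noncomputable def weylZ (φ : ℂ → ℝ → ℂ) (z : ℂ) : ℂ := -endValue 0 (φ z) / endValue 2 (φ z)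

end CubicString

namespace CubicString

/-! Between masses the solution is quadratic, and at a mass only its second derivative jumps. So the
data (φ, φ', φ'') just after a mass are real polynomials (A, B, D) in z, produced by an elementary
recursion (`transfer`), and the spectrum of type 2 is the zero set of the final D
(`spectrumType2_eq`).

The engine is the bilinear concomitant φφ̃'' - φ'φ̃' + φ''φ̃ of the solutions for z and -z. It is
constant along the string and vanishes at 0, so A(z)D(-z) - B(z)B(-z) + A(-z)D(z) = 0. On the
negative axis D is positive and A, B are nonnegative. Hence at a zero of D the identity ties the
sign of A to that of B, and this makes the zeros of consecutive D's interlace. The induction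
`IsStieltjes.step` gives k simple positive zeros after k masses, and alternating signs of B at them,
which makes all weights -B/D' positive.

Since A and B have smaller degree than D, both Weyl functions are sums of simple fractions. At a
zero y of D the concomitant reads A(y)D(-y) = B(y)B(-y), so the residue of Z at y is the weight
there times -W(-y). Expanding W(-y) yields the double integral (`IsStieltjes.weyl_fst`).

The link with distributions is `isSolution_iff`: subtracting the contribution of the point masses
leaves a continuous function with zero third derivative, which is quadratic by mollification. -/

/-! ### Transfer polynomials: signs and interlacing of zeros -/

open Polynomial in
/-- The data `(φ, φ', φ'')` just after the first `k` masses `m` separated by gaps `l`, as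
polynomials in the spectral parameter. -/
noncomputable def transfer (l m : ℕ → ℝ) : ℕ → ℝ[X] × ℝ[X] × ℝ[X]
  | 0 => (0, 0, 1)
  | k + 1 =>
    let T := transfer l m k
    let A := T.1 + C (l k) * T.2.1 + C (l k ^ 2 / 2) * T.2.2
    (A, T.2.1 + C (l k) * T.2.2, T.2.2 - C (m k) * X * A)

open Polynomial in
/-- Spectral properties of the data at the right end of a string with `k` masses. -/
structure IsStieltjes (k : ℕ) (A B D : ℝ[X]) (y : ℕ → ℝ) (e : ℝ) : Prop where
  -- The conserved concomitant of the solutions for x and -x.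
  concomitant : ∀ x, A.eval x * D.eval (-x) - B.eval x * B.eval (-x) + A.eval (-x) * D.eval x = 0
  -- Only weak inequalities for A and B, because both vanish for k = 0.
  fst_neg : ∀ x, 0 < x → 0 ≤ A.eval (-x)
  snd_neg : ∀ x, 0 < x → 0 ≤ B.eval (-x)
  thd_neg : ∀ x, 0 < x → 0 < D.eval (-x)
  thd_zero : D.eval 0 = 1
  eq_nodal : D = C e * Lagrange.nodal (Finset.range k) y
  sign : 0 < (-1) ^ k * e
  pos : ∀ i < k, 0 < y i
  lt : ∀ i j, i < j → j < k → y i < y j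
  -- Strict, since the data are taken after a mass, whose jump raises the degree of D alone.
  deg_fst : A.degree < k
  deg_snd : B.degree < k
  sign_snd : ∀ j < k, 0 < (-1) ^ j * B.eval (y j)

/-- Exactly the factors with index below j are negative; pairing each with one factor -1 makes the
whole product positive. -/
lemma prod_sub_sign (s : Finset ℕ) (j : ℕ) (y : ℕ → ℝ) (x : ℝ) (h1 : ∀ i ∈ s, i < j → y i < x)
    (h2 : ∀ i ∈ s, j ≤ i → x < y i) :
    0 < (-1) ^ (s.filter (· < j)).card * ∏ i ∈ s, (y i - x) := by
  have h : (-1 : ℝ) ^ (s.filter (· < j)).card = ∏ i ∈ s, if i < j then -1 else 1 := by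
    rw [Finset.prod_ite]
    simp
  rw [h, ← Finset.prod_mul_distrib]
  refine Finset.prod_pos fun i hi => ?_
  split_ifs with hij
  · linarith [h1 i hi hij]
  · linarith [h2 i hi (not_lt.1 hij)]

lemma eval_nodal_sign {k j : ℕ} (hj : j ≤ k) (y : ℕ → ℝ) (x e : ℝ) (he : 0 < (-1) ^ k * e)
    (h1 : ∀ i < j, y i < x) (h2 : ∀ i < k, j ≤ i → x < y i) :
    0 < (-1) ^ j * (e * (Lagrange.nodal (Finset.range k) y).eval x) := by
  have h := prod_sub_sign (Finset.range k) j y x (fun i _ => h1 i)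
    (fun i hi => h2 i (Finset.mem_range.1 hi))
  have hc : (Finset.range k).filter (· < j) = Finset.range j := by
    ext i; simp; omega
  rw [hc, Finset.card_range] at h
  have h3 : ∏ i ∈ Finset.range k, (y i - x) = (-1) ^ k * ∏ i ∈ Finset.range k, (x - y i) := by
    nth_rewrite 2 [← Finset.card_range k]
    rw [← Finset.prod_neg]
    simp
  rw [Lagrange.eval_nodal]
  rw [h3] at h
  have h4 := mul_pos h he
  have h5 : ((-1 : ℝ) ^ k) * (-1) ^ k = 1 := by rw [← mul_pow]; simp
  calc 0 < _ := h4
    _ = ((-1 : ℝ) ^ k * (-1) ^ k) *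
      ((-1) ^ j * (e * ∏ i ∈ Finset.range k, (x - y i))) := by ring
    _ = _ := by rw [h5, one_mul]

lemma deriv_nodal_sign {k j : ℕ} (hj : j < k) (y : ℕ → ℝ) (e : ℝ) (he : 0 < (-1) ^ k * e)
    (hy : ∀ i j, i < j → j < k → y i < y j) :
    (-1) ^ j * (e * (Polynomial.derivative (Lagrange.nodal (Finset.range k) y)).eval (y j)) < 0 := by
  have h := prod_sub_sign ((Finset.range k).erase j) j y (y j)
    (fun i hi hij => hy i j hij hj)
    (fun i hi hij => by
      simp only [Finset.mem_erase, Finset.mem_range] at hi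
      exact hy j i (lt_of_le_of_ne hij (Ne.symm hi.1)) hi.2)
  have hc : ((Finset.range k).erase j).filter (· < j) = Finset.range j := by
    ext i; simp; omega
  rw [hc, Finset.card_range] at h
  have hcard : ((Finset.range k).erase j).card + 1 = k := by
    rw [Finset.card_erase_of_mem (Finset.mem_range.2 hj), Finset.card_range]; omega
  have h3 : ∏ i ∈ (Finset.range k).erase j, (y i - y j)
      = (-1) ^ ((Finset.range k).erase j).card * ∏ i ∈ (Finset.range k).erase j, (y j - y i) := by
    rw [← Finset.prod_neg]
    simp
  rw [Lagrange.eval_nodal_derivative_eval_node_eq (Finset.mem_range.2 hj), Lagrange.eval_nodal]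
  rw [h3] at h
  generalize ((Finset.range k).erase j).card = r at h hcard
  subst hcard
  have h4 := mul_pos h he
  have h5 : ((-1 : ℝ) ^ r) * (-1) ^ r = 1 := by rw [← mul_pow]; simp
  have h6 : 0 < -(((-1 : ℝ) ^ r * (-1) ^ r) *
      ((-1) ^ j * (e * ∏ i ∈ (Finset.range (r + 1)).erase j, (y j - y i)))) := by
    refine h4.trans_eq ?_
    ring
  rw [h5, one_mul] at h6
  linarith

open Polynomial in
lemma IsStieltjes.zero (y : ℕ → ℝ) : IsStieltjes 0 0 0 1 y 1 := by
  constructor <;> simp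

lemma exists_interlacing_zeros {k : ℕ} {f : ℝ → ℝ} (hf : Continuous f) {t : ℕ → ℝ}
    (ht : ∀ j < k, t j < t (j + 1)) (h : ∀ j ≤ k, 0 < (-1) ^ j * f (t j)) :
    ∃ u : ℕ → ℝ, ∀ j < k, t j < u j ∧ u j < t (j + 1) ∧ f (u j) = 0 := by
  have key : ∀ j, ∃ x, j < k → t j < x ∧ x < t (j + 1) ∧ f x = 0 := by
    intro j
    by_cases hj : j < k
    · have h1 := h j hj.le
      have h2 := h (j + 1) hj
      have hc : ContinuousOn (fun x => (-1) ^ j * f x) (Set.Icc (t j) (t (j + 1))) :=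
        (continuous_const.mul hf).continuousOn
      obtain ⟨x, hx, hx0⟩ := intermediate_value_Ioo' (ht j hj).le hc
        (show (0 : ℝ) ∈ Set.Ioo _ _ from ⟨by simp only [pow_succ] at h2; linarith, h1⟩)
      refine ⟨x, fun _ => ⟨hx.1, hx.2, ?_⟩⟩
      simpa using hx0
    · exact ⟨0, fun h => absurd h hj⟩
  choose u hu using key
  exact ⟨u, hu⟩

open Polynomial in
-- A gap followed by a mass. At the old zeros and at 0 the new D has alternating signs, and its
-- leading coefficient fixes the sign at infinity; this locates all k + 1 new zeros. The concomitant
-- is then used a second time, at the new zeros, to recover the signs of B.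
theorem IsStieltjes.step {k : ℕ} {A B D : ℝ[X]} {y : ℕ → ℝ} {e : ℝ} (h : IsStieltjes k A B D y e)
    {l m : ℝ} (hl : 0 < l) (hm : 0 < m) :
    ∃ y' e', IsStieltjes (k + 1) (A + C l * B + C (l ^ 2 / 2) * D) (B + C l * D)
      (D - C m * X * (A + C l * B + C (l ^ 2 / 2) * D)) y' e' := by
  set A' := A + C l * B + C (l ^ 2 / 2) * D with hA'
  set B' := B + C l * D with hB'
  set D' := D - C m * X * A' with hD'
  have eA : ∀ x, A'.eval x = A.eval x + l * B.eval x + l ^ 2 / 2 * D.eval x := by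
    intro x; simp [hA']
  have eB : ∀ x, B'.eval x = B.eval x + l * D.eval x := by intro x; simp [hB']
  have eD : ∀ x, D'.eval x = D.eval x - m * x * A'.eval x := by intro x; simp [hD']
  have eN : ∀ x, D.eval x = e * (Lagrange.nodal (Finset.range k) y).eval x := by
    intro x; rw [h.eq_nodal]; simp
  have hDroot : ∀ j < k, D.eval (y j) = 0 := by
    intro j hj
    rw [eN, Lagrange.eval_nodal_at_node (Finset.mem_range.2 hj), mul_zero]
  have he0 : e ≠ 0 := by rintro rfl; simpa using h.sign
  have hconc : ∀ x, A'.eval x * D.eval (-x) - B'.eval x * B'.eval (-x)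
      + A'.eval (-x) * D.eval x = 0 := by
    intro x
    rw [eA, eA, eB, eB]
    linear_combination h.concomitant x
  have hA'neg : ∀ x, 0 < x → 0 < A'.eval (-x) := by
    intro x hx
    rw [eA]
    have := h.fst_neg x hx
    have := h.snd_neg x hx
    have := h.thd_neg x hx
    positivity
  have hB'neg : ∀ x, 0 < x → 0 < B'.eval (-x) := by
    intro x hx
    rw [eB]
    have := h.snd_neg x hx
    have := h.thd_neg x hx
    positivity
  have hD'neg : ∀ x, 0 < x → 0 < D'.eval (-x) := by
    intro x hx
    rw [eD]
    have := mul_pos (mul_pos hm hx) (hA'neg x hx)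
    linarith [h.thd_neg x hx]
  have hA'sign : ∀ j < k, 0 < (-1) ^ j * A'.eval (y j) := by
    intro j hj
    have hc := h.concomitant (y j)
    rw [hDroot j hj, mul_zero, add_zero] at hc
    have h1 := h.thd_neg _ (h.pos j hj)
    have h2 := h.snd_neg _ (h.pos j hj)
    have h3 := h.sign_snd j hj
    -- At a zero of D the concomitant reduces to A(y)D(-y) = B(y)B(-y), so A inherits the sign of B.
    have h4 : 0 ≤ (-1) ^ j * A.eval (y j) := by
      have : 0 ≤ ((-1) ^ j * A.eval (y j)) * D.eval (-y j) := by
        calc 0 ≤ ((-1) ^ j * B.eval (y j)) * B.eval (-y j) := mul_nonneg h3.le h2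
          _ = _ := by linear_combination -(-1) ^ j * hc
      exact nonneg_of_mul_nonneg_left this h1
    rw [eA, hDroot j hj]
    have := mul_pos hl h3
    linarith
  -- the leading term of `D'`
  set e' := -(m * (l ^ 2 / 2) * e) with he'
  have he'0 : e' ≠ 0 := by simp [he', hm.ne', hl.ne', he0]
  -- `R` collects the part of `D'` of degree at most k.
  set R := D - C m * X * (A + C l * B) with hR
  set M := C e' * (X * Lagrange.nodal (Finset.range k) y) with hM
  have hdec : D' = R + M := by
    have : C e' = -(C m * C (l ^ 2 / 2) * C e) := by simp [he']
    rw [hD', hR, hM, hA', this]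
    linear_combination -(C m * X * C (l ^ 2 / 2)) * h.eq_nodal
  have hXn : (X * Lagrange.nodal (Finset.range k) y).Monic :=
    monic_X.mul Lagrange.nodal_monic
  have hXd : (X * Lagrange.nodal (Finset.range k) y).degree = ((k + 1 : ℕ) : WithBot ℕ) := by
    rw [degree_mul, degree_X, Lagrange.degree_nodal, Finset.card_range]
    push_cast; ring
  have hDdeg : D.degree = (k : WithBot ℕ) := by
    rw [h.eq_nodal, degree_C_mul he0, Lagrange.degree_nodal, Finset.card_range]
  have hABdeg : (A + C l * B).degree < (k : WithBot ℕ) := by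
    refine (degree_add_le _ _).trans_lt (max_lt h.deg_fst ?_)
    rw [degree_C_mul hl.ne']
    exact h.deg_snd
  have hk1 : (k : WithBot ℕ) < ((k + 1 : ℕ) : WithBot ℕ) := by exact_mod_cast Nat.lt_succ_self k
  have hRdeg : R.degree < ((k + 1 : ℕ) : WithBot ℕ) := by
    refine (degree_sub_le _ _).trans_lt (max_lt (hDdeg.trans_lt hk1) ?_)
    by_cases h0 : A + C l * B = 0
    · rw [h0, mul_zero, degree_zero]; exact WithBot.bot_lt_coe _
    · rw [mul_assoc, degree_C_mul hm.ne', degree_mul, degree_X, degree_eq_natDegree h0]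
      rw [degree_eq_natDegree h0] at hABdeg
      have h1 : (A + C l * B).natDegree < k := by exact_mod_cast hABdeg
      have h2 : 1 + (A + C l * B).natDegree < k + 1 := by omega
      exact_mod_cast h2
  have hMdeg : M.degree = ((k + 1 : ℕ) : WithBot ℕ) := by
    rw [hM, degree_C_mul he'0, hXd]
  have hMlead : M.leadingCoeff = e' := by
    rw [hM, leadingCoeff_mul, hXn.leadingCoeff, leadingCoeff_C, mul_one]
  have hD'deg : D'.degree = ((k + 1 : ℕ) : WithBot ℕ) := by
    rw [hdec, degree_add_eq_right_of_degree_lt (hMdeg ▸ hRdeg), hMdeg]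
  have hD'lead : D'.leadingCoeff = e' := by
    rw [hdec, leadingCoeff_add_of_degree_lt (hMdeg ▸ hRdeg), hMlead]
  have he'sign : 0 < (-1) ^ (k + 1) * e' := by
    have h1 : (-1) ^ (k + 1) * e' = m * (l ^ 2 / 2) * ((-1) ^ k * e) := by rw [he']; ring
    rw [h1]
    have := h.sign
    positivity
  -- interlacing
  have htop : Tendsto (fun x => (-1) ^ (k + 1) * D'.eval x) atTop atTop := by
    have h1 := tendsto_atTop_of_leadingCoeff_nonneg (C ((-1) ^ (k + 1)) * D')
      (by rw [degree_C_mul (by simp), hD'deg]; exact_mod_cast Nat.succ_pos k)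
      (by rw [leadingCoeff_mul, leadingCoeff_C, hD'lead]; exact he'sign.le)
    simpa only [eval_mul, eval_C] using h1
  obtain ⟨x1, hx1, hx1p⟩ := ((htop.eventually_gt_atTop 0).and
    (eventually_gt_atTop (∑ j ∈ Finset.range k, |y j|))).exists
  have hybd : ∀ j < k, y j < x1 := fun j hj =>
    ((le_abs_self _).trans (Finset.single_le_sum (f := fun j => |y j|)
      (fun _ _ => abs_nonneg _) (Finset.mem_range.2 hj))).trans_lt hx1p
  have hx1pos : 0 < x1 := (Finset.sum_nonneg fun _ _ => abs_nonneg _).trans_lt hx1p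
  -- Test points 0 < y 0 < ... < y (k - 1) < x1, at which the sign of `D'` alternates starting from
  -- `D'(0) = 1`; the index is shifted by one against `y`.
  let t : ℕ → ℝ := fun j => if j = 0 then 0 else if j - 1 < k then y (j - 1) else x1
  have t0 : t 0 = 0 := by simp [t]
  have ts : ∀ j < k, t (j + 1) = y j := by intro j hj; simp [t, hj]
  have tk : t (k + 1) = x1 := by simp [t]
  have htlt : ∀ j < k + 1, t j < t (j + 1) := by
    intro j hj
    rcases j with _ | j
    · rw [t0]
      rcases Nat.eq_zero_or_pos k with hk | hk
      · subst hk; rw [tk]; exact hx1pos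
      · rw [ts 0 hk]; exact h.pos 0 hk
    · rw [ts j (by omega)]
      by_cases hjk : j + 1 < k
      · rw [ts _ hjk]; exact h.lt _ _ (Nat.lt_succ_self j) hjk
      · have : j + 1 = k := by omega
        rw [this, tk]; exact hybd j (by omega)
  have htsign : ∀ j ≤ k + 1, 0 < (-1) ^ j * D'.eval (t j) := by
    intro j hj
    rcases j with _ | j
    · rw [t0, eD, h.thd_zero]; simp
    · by_cases hjk : j < k
      · rw [ts j hjk, eD, hDroot j hjk]
        have := mul_pos (mul_pos hm (h.pos j hjk)) (hA'sign j hjk)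
        calc 0 < _ := this
          _ = _ := by ring
      · have : j = k := by omega
        rw [this, tk]; exact hx1
  obtain ⟨u, hu⟩ := exists_interlacing_zeros D'.continuous htlt htsign
  have htpos : ∀ j ≤ k, 0 ≤ t j := by
    intro j hj
    rcases j with _ | j
    · exact t0.ge
    · rw [ts j (by omega)]; exact (h.pos j (by omega)).le
  have hupos : ∀ i < k + 1, 0 < u i := fun i hi =>
    (htpos i (by omega)).trans_lt (hu i hi).1
  have hyu : ∀ i j, i < j → j < k + 1 → y i < u j := by
    intro i j hij hj
    obtain ⟨j, rfl⟩ : ∃ j', j = j' + 1 := ⟨j - 1, by omega⟩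
    have h1 := (hu (j + 1) hj).1
    rw [ts j (by omega)] at h1
    rcases (Nat.lt_succ_iff.1 hij).eq_or_lt with h2 | h2
    · rw [h2]; exact h1
    · exact (h.lt i j h2 (by omega)).trans h1
  have huy : ∀ i j, j ≤ i → i < k → u j < y i := by
    intro i j hij hi
    have h1 := (hu j (by omega)).2.1
    rw [ts j (by omega)] at h1
    rcases hij.eq_or_lt with h2 | h2
    · rw [← h2]; exact h1
    · exact h1.trans (h.lt j i h2 hi)
  have hult : ∀ i j, i < j → j < k + 1 → u i < u j := fun i j hij hj =>
    (huy i i le_rfl (by omega)).trans (hyu i j hij hj)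
  have hinj : Set.InjOn u (Finset.range (k + 1)) := by
    intro i hi j hj hij
    simp only [Finset.coe_range, Set.mem_Iio] at hi hj
    rcases lt_trichotomy i j with h1 | h1 | h1
    · exact absurd hij (hult i j h1 hj).ne
    · exact h1
    · exact absurd hij (hult j i h1 hi).ne'
  -- Both sides have degree k + 1 and the same leading coefficient, so their difference has degree
  -- at most k; it vanishes at k + 1 points.
  have hnodal : D' = C e' * Lagrange.nodal (Finset.range (k + 1)) u := by
    have hdN : (Lagrange.nodal (Finset.range (k + 1)) u).degree = ((k + 1 : ℕ) : WithBot ℕ) := by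
      rw [Lagrange.degree_nodal, Finset.card_range]
    refine sub_eq_zero.1 (eq_zero_of_degree_lt_of_eval_index_eq_zero (v := u)
      (Finset.range (k + 1)) hinj ?_ ?_)
    · rw [Finset.card_range, ← hD'deg]
      refine degree_sub_lt_left ?_ ?_ ?_
      · rw [degree_C_mul he'0, hdN, hD'deg]
      · rintro h0
        rw [h0, degree_zero] at hD'deg
        exact WithBot.bot_ne_coe hD'deg
      · rw [leadingCoeff_mul, leadingCoeff_C, Lagrange.nodal_monic.leadingCoeff, mul_one, hD'lead]
    · intro i hi
      rw [eval_sub, eval_mul, Lagrange.eval_nodal_at_node hi, (hu i (Finset.mem_range.1 hi)).2.2]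
      simp
  refine ⟨u, e', ⟨?_, fun x hx => (hA'neg x hx).le, fun x hx => (hB'neg x hx).le, hD'neg, ?_,
    hnodal, he'sign, hupos, hult, ?_, ?_, ?_⟩⟩
  · intro x
    rw [eD, eD]
    linear_combination hconc x
  · rw [eD, h.thd_zero]; simp
  · refine (degree_add_le _ _).trans_lt (max_lt (hABdeg.trans hk1) ?_)
    rw [degree_C_mul (by positivity), hDdeg]; exact hk1
  · refine (degree_add_le _ _).trans_lt (max_lt (h.deg_snd.trans hk1) ?_)
    rw [degree_C_mul hl.ne', hDdeg]; exact hk1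
  · intro j hj
    have hup := hupos j hj
    have hDs : 0 < (-1) ^ j * D.eval (u j) := by
      rw [eN]
      exact eval_nodal_sign (by omega) y (u j) e h.sign (fun i hi => hyu i j hi hj)
        (fun i hi hji => huy i j hji hi)
    have h0 := (hu j hj).2.2
    rw [eD] at h0
    have hc := hconc (u j)
    have hBn := hB'neg _ hup
    have hAn := hA'neg _ hup
    have hDn := h.thd_neg _ hup
    have hmu := mul_pos hm hup
    -- At a new zero u one has D(u) = m u A'(u). Multiplying the concomitant by m u therefore gives
    -- m u B'(u)B'(-u) = D(u)(D(-u) + m u A'(-u)), and interlacing determines the sign of D(u).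
    have h1 : 0 < ((-1) ^ j * B'.eval (u j)) * (B'.eval (-u j) * (m * u j)) := by
      calc 0 < ((-1) ^ j * D.eval (u j)) * (D.eval (-u j) + A'.eval (-u j) * (m * u j)) := by
            positivity
        _ = _ := by
          linear_combination (-1) ^ j * D.eval (-u j) * h0 + (-1) ^ j * (m * u j) * hc
    exact pos_of_mul_pos_left h1 (by positivity)

theorem exists_isStieltjes_transfer {l m : ℕ → ℝ} (N : ℕ) (hl : ∀ k < N, 0 < l k)
    (hm : ∀ k < N, 0 < m k) :
    ∃ y e, IsStieltjes N (transfer l m N).1 (transfer l m N).2.1 (transfer l m N).2.2 y e := by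
  induction N with
  | zero => exact ⟨fun _ => 0, 1, IsStieltjes.zero _⟩
  | succ k ih =>
    obtain ⟨y, e, h⟩ := ih (fun i hi => hl i (by omega)) (fun i hi => hm i (by omega))
    exact h.step (hl k (by omega)) (hm k (by omega))

/-! ### The third derivative in the sense of distributions -/

lemma iteratedDeriv_three_eq (f : ℝ → ℝ) : iteratedDeriv 3 f = deriv (deriv (deriv f)) := by
  simp [iteratedDeriv_succ, iteratedDeriv_zero]

lemma continuous_deriv3 {η : ℝ → ℝ} (hη : ContDiff ℝ ∞ η) : Continuous (iteratedDeriv 3 η) := by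
  rw [iteratedDeriv_three_eq]
  exact (contDiff_infty_iff_deriv.1 (contDiff_infty_iff_deriv.1
    (contDiff_infty_iff_deriv.1 hη).2).2).2.continuous

lemma hasCompactSupport_deriv3 {η : ℝ → ℝ} (hηc : HasCompactSupport η) :
    HasCompactSupport (iteratedDeriv 3 η) := by
  rw [iteratedDeriv_three_eq]; exact hηc.deriv.deriv.deriv

/-- A `C³` function with vanishing third derivative is determined by three of its values. -/
lemma eq_interpolation_of_deriv3_eq_zero {u u1 u2 : ℝ → ℂ} (h0 : ∀ x, HasDerivAt u (u1 x) x)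
    (h1 : ∀ x, HasDerivAt u1 (u2 x) x) (h2 : ∀ x, HasDerivAt u2 0 x) (x : ℝ) :
    u x = u 0 + ((u 1 - u (-1)) / 2) * x + ((u 1 + u (-1) - 2 * u 0) / 2) * x ^ 2 := by
  have c2 : ∀ x, u2 x = u2 0 := fun x => is_const_of_deriv_eq_zero
    (fun x => (h2 x).differentiableAt) (fun x => (h2 x).deriv) x 0
  have d1 : ∀ x : ℝ, HasDerivAt (fun x : ℝ => u1 x - u2 0 * x) 0 x := by
    intro x
    have := (h1 x).sub ((Complex.ofRealCLM.hasDerivAt (x := x)).const_mul (u2 0))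
    exact this.congr_deriv (by simp [c2 x])
  have c1 : ∀ x : ℝ, u1 x = u1 0 + u2 0 * x := fun x => by
    have := is_const_of_deriv_eq_zero (fun x => (d1 x).differentiableAt) (fun x => (d1 x).deriv) x 0
    simp at this
    linear_combination this
  have d0 : ∀ x : ℝ, HasDerivAt (fun x : ℝ => u x - (u1 0 * x + u2 0 / 2 * (x : ℂ) ^ 2)) 0 x := by
    intro x
    have hx := Complex.ofRealCLM.hasDerivAt (x := x)
    have := (h0 x).sub ((hx.const_mul (u1 0)).add ((hx.pow 2).const_mul (u2 0 / 2)))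
    refine this.congr_deriv ?_
    rw [c1 x]
    simp
    ring
  have c0 : ∀ x : ℝ, u x = u 0 + u1 0 * x + u2 0 / 2 * (x : ℂ) ^ 2 := fun x => by
    have := is_const_of_deriv_eq_zero (fun x => (d0 x).differentiableAt) (fun x => (d0 x).deriv) x 0
    simp at this
    linear_combination this
  rw [c0 x, c0 1, c0 (-1)]
  push_cast
  ring

/-- The third derivative of the mollified function at x is, up to sign, the pairing of h with the
third derivative of the test function t ↦ ρ(x - t), hence zero. The quadratic is written through the
values at 0, 1, -1 because these survive a pointwise limit. -/
lemma ContDiffBump.convolution_eq_interpolation {h : ℝ → ℂ} (hc : Continuous h)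
    (hw : ∀ η : ℝ → ℝ, ContDiff ℝ ∞ η → HasCompactSupport η →
      ∫ x, iteratedDeriv 3 η x • h x = 0) (ρ : ContDiffBump (0 : ℝ)) (u : ℝ → ℂ)
    (hu : u = convolution (ρ.normed volume) h (ContinuousLinearMap.lsmul ℝ ℝ) volume) (x : ℝ) :
    u x = u 0 + ((u 1 - u (-1)) / 2) * x + ((u 1 + u (-1) - 2 * u 0) / 2) * x ^ 2 := by
  set r := ρ.normed volume with hr
  have hrs : ContDiff ℝ ∞ r := ρ.contDiff_normed
  have hrc : HasCompactSupport r := ρ.hasCompactSupport_normed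
  have hl : LocallyIntegrable h volume := hc.locallyIntegrable
  have hr1 : ContDiff ℝ ∞ (deriv r) := by
    exact ((contDiff_infty_iff_deriv.1 hrs).2)
  have hr2 : ContDiff ℝ ∞ (deriv (deriv r)) := by
    exact ((contDiff_infty_iff_deriv.1 hr1).2)
  have hle : (1 : WithTop ℕ∞) ≤ ∞ := by exact_mod_cast le_top
  have d0 := HasCompactSupport.hasDerivAt_convolution_left (ContinuousLinearMap.lsmul ℝ ℝ)
    hrc (hrs.of_le hle) hl
  have d1 := HasCompactSupport.hasDerivAt_convolution_left (ContinuousLinearMap.lsmul ℝ ℝ)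
    hrc.deriv (hr1.of_le hle) hl
  have d2 := HasCompactSupport.hasDerivAt_convolution_left (ContinuousLinearMap.lsmul ℝ ℝ)
    hrc.deriv.deriv (hr2.of_le hle) hl
  rw [hu]
  refine eq_interpolation_of_deriv3_eq_zero d0 d1 (fun x => ?_) x
  refine (d2 x).congr_deriv ?_
  rw [convolution_eq_swap]
  have hη : ContDiff ℝ ∞ (fun t => r (x - t)) := hrs.comp (contDiff_const.sub contDiff_id)
  have hηc : HasCompactSupport (fun t => r (x - t)) :=
    hrc.comp_homeomorph (Homeomorph.subLeft x)
  have := hw _ hη hηc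
  rw [iteratedDeriv_comp_const_sub, iteratedDeriv_three_eq] at this
  simp only [ContinuousLinearMap.lsmul_apply]
  have h3 : ∫ t, ((-1 : ℝ) ^ 3 • deriv (deriv (deriv r)) (x - t)) • h t
      = - ∫ t, deriv (deriv (deriv r)) (x - t) • h t := by
    rw [← integral_neg]
    congr 1; ext t
    norm_num
  rw [h3] at this
  simpa using this

/-- A continuous function whose third distributional derivative vanishes is quadratic. -/
theorem eq_quadratic_of_weak_deriv3_eq_zero {h : ℝ → ℂ} (hc : Continuous h)
    (hw : ∀ η : ℝ → ℝ, ContDiff ℝ ∞ η → HasCompactSupport η →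
      ∫ x, iteratedDeriv 3 η x • h x = 0) :
    ∃ a b c : ℂ, ∀ x : ℝ, h x = a + b * x + c * x ^ 2 := by
  -- The coefficients interpolate h at -1, 0, 1; each mollification satisfies the same formula,
  -- which passes to the limit.
  refine ⟨h 0, (h 1 - h (-1)) / 2, (h 1 + h (-1) - 2 * h 0) / 2, fun x => ?_⟩
  let ρ : ℕ → ContDiffBump (0 : ℝ) := fun n =>
    ⟨1 / ((n : ℝ) + 1) / 2, 1 / ((n : ℝ) + 1), by positivity, half_lt_self (by positivity)⟩
  have hρ : Tendsto (fun n => (ρ n).rOut) atTop (𝓝 0) := tendsto_one_div_add_atTop_nhds_zero_nat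
  let u : ℕ → ℝ → ℂ := fun n =>
    convolution ((ρ n).normed volume) h (ContinuousLinearMap.lsmul ℝ ℝ) volume
  have hu : ∀ x, Tendsto (fun n => u n x) atTop (𝓝 (h x)) := fun x =>
    ContDiffBump.convolution_tendsto_right_of_continuous hρ hc x
  have heq : ∀ n, u n x = u n 0 + ((u n 1 - u n (-1)) / 2) * x
      + ((u n 1 + u n (-1) - 2 * u n 0) / 2) * x ^ 2 := fun n =>
    ContDiffBump.convolution_eq_interpolation hc hw (ρ n) (u n) rfl x
  refine tendsto_nhds_unique (hu x) ?_
  simp_rw [heq]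
  exact ((hu 0).add ((((hu 1).sub (hu (-1))).div_const 2).mul_const _)).add
    (((((hu 1).add (hu (-1))).sub ((hu 0).const_mul 2)).div_const 2).mul_const _)

/-- The fundamental solution `(x - a)₊² / 2` of the third derivative. -/
noncomputable def kernel (a x : ℝ) : ℝ := (max (x - a) 0) ^ 2 / 2

lemma continuous_kernel (a : ℝ) : Continuous (kernel a) := by
  unfold kernel; fun_prop

lemma kernel_of_le {a x : ℝ} (h : x ≤ a) : kernel a x = 0 := by
  rw [kernel, max_eq_right (by linarith)]; simp

lemma kernel_of_ge {a x : ℝ} (h : a ≤ x) : kernel a x = (x - a) ^ 2 / 2 := by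
  rw [kernel, max_eq_left (by linarith)]

/-- The primitive of `η''' q` for a quadratic `q = α + β x + γ x² / 2`. -/
lemma deriv_quadratic_primitive {η : ℝ → ℝ} (hη : ContDiff ℝ ∞ η) (hηc : HasCompactSupport η)
    (α β γ : ℝ) :
    ∃ F : ℝ → ℝ, ContDiff ℝ 1 F ∧ HasCompactSupport F ∧
      (∀ x, deriv F x = iteratedDeriv 3 η x * (α + β * x + γ * x ^ 2 / 2)) ∧
      ∀ x, α + β * x + γ * x ^ 2 / 2 = 0 → β + γ * x = 0 → F x = γ * η x := by
  have h1 : ContDiff ℝ ∞ (deriv η) := (contDiff_infty_iff_deriv.1 hη).2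
  have h2 : ContDiff ℝ ∞ (deriv (deriv η)) := (contDiff_infty_iff_deriv.1 h1).2
  have hle : (1 : WithTop ℕ∞) ≤ ∞ := by exact_mod_cast le_top
  have hne : (∞ : WithTop ℕ∞) ≠ 0 := by simp
  -- Repeated integration by parts: F = η''q - η'q' + ηq''. At a double zero of q only the last term
  -- survives.
  refine ⟨fun x => deriv (deriv η) x * (α + β * x + γ * x ^ 2 / 2) - deriv η x * (β + γ * x)
    + η x * γ, ?_, ?_, ?_, ?_⟩
  · exact (((h2.of_le hle).mul (by fun_prop)).sub ((h1.of_le hle).mul (by fun_prop))).add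
      ((hη.of_le hle).mul (by fun_prop))
  · exact ((hηc.deriv.deriv.mul_right).sub (hηc.deriv.mul_right)).add hηc.mul_right
  · intro x
    have e0 := (hη.differentiable hne x).hasDerivAt
    have e1 := (h1.differentiable hne x).hasDerivAt
    have e2 := (h2.differentiable hne x).hasDerivAt
    have q1 : HasDerivAt (fun x : ℝ => β + γ * x) γ x := by
      simpa using ((hasDerivAt_id x).const_mul γ).const_add β
    have q0 : HasDerivAt (fun x : ℝ => α + β * x + γ * x ^ 2 / 2) (β + γ * x) x := by
      have := (((hasDerivAt_id x).const_mul β).const_add α).add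
        ((((hasDerivAt_id x).pow 2).const_mul γ).div_const 2)
      refine this.congr_deriv ?_
      simp
      ring
    rw [iteratedDeriv_three_eq]
    have := (((e2.mul q0).sub (e1.mul q1)).add (e0.mul_const γ)).deriv
    refine Eq.trans this ?_
    ring
  · intro x hx hx'
    simp only [hx, hx']
    ring

lemma integral_deriv3_mul_quadratic {η : ℝ → ℝ} (hη : ContDiff ℝ ∞ η) (hηc : HasCompactSupport η)
    (α β γ : ℝ) : ∫ x, iteratedDeriv 3 η x * (α + β * x + γ * x ^ 2 / 2) = 0 := by
  obtain ⟨F, hF, hFc, hd, -⟩ := deriv_quadratic_primitive hη hηc α β γ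
  rw [← funext hd]
  have hi : Integrable (deriv F) := (hF.continuous_deriv le_rfl).integrable_of_hasCompactSupport hFc.deriv
  rw [← intervalIntegral.integral_Iic_add_Ioi (b := 0) hi.integrableOn hi.integrableOn,
    hFc.integral_Ioi_deriv_eq hF, hFc.integral_Iic_deriv_eq hF]
  ring

/-- To the right of a the kernel is a quadratic with a double zero at a, so the integral is -F(a)
for the primitive F, and F(a) = η(a). -/
lemma integral_deriv3_mul_kernel {η : ℝ → ℝ} (hη : ContDiff ℝ ∞ η) (hηc : HasCompactSupport η)
    (a : ℝ) : ∫ x, iteratedDeriv 3 η x * kernel a x = -η a := by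
  obtain ⟨F, hF, hFc, hd, h0⟩ := deriv_quadratic_primitive hη hηc (a ^ 2 / 2) (-a) 1
  have h1 : (fun x => iteratedDeriv 3 η x * kernel a x) = (Set.Ioi a).indicator (deriv F) := by
    ext x
    by_cases hx : a < x
    · rw [Set.indicator_of_mem (Set.mem_Ioi.2 hx), hd, kernel_of_ge hx.le]; ring
    · rw [Set.indicator_of_notMem (by simpa using hx), kernel_of_le (not_lt.1 hx), mul_zero]
  rw [h1, integral_indicator measurableSet_Ioi, hFc.integral_Ioi_deriv_eq hF,
    h0 a (by ring) (by ring), one_mul]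

/-! ### Point masses and weak solutions -/

section PointMasses

variable {N : ℕ} {w p : Fin N → ℝ}

lemma integrable_pointMasses {E : Type*} [NormedAddCommGroup E] (f : ℝ → E) :
    Integrable f (pointMasses w p) := by
  refine integrable_finsetSum_measure.2 fun i _ => ?_
  exact (integrable_dirac (by simp)).smul_measure (by simp)

lemma integral_pointMasses (hw : ∀ i, 0 < w i) (f : ℝ → ℂ) :
    ∫ x, f x ∂(pointMasses w p) = ∑ i, (w i : ℂ) * f (p i) := by
  rw [pointMasses, integral_finsetSum_measure
    fun i _ => (integrable_dirac (by simp)).smul_measure (by simp)]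
  refine Finset.sum_congr rfl fun i _ => ?_
  rw [integral_smul_measure, integral_dirac, ENNReal.toReal_ofReal (hw i).le]
  simp

lemma pointMasses_prod : (pointMasses w p).prod (pointMasses w p) =
    ∑ q : Fin N × Fin N, (ENNReal.ofReal (w q.1) * ENNReal.ofReal (w q.2)) •
      Measure.dirac (p q.1, p q.2) := by
  rw [pointMasses, ← Measure.sum_fintype, Measure.prod_sum, Measure.sum_fintype]
  refine Finset.sum_congr rfl fun q _ => ?_
  rw [Measure.prod_smul_left, Measure.prod_smul_right, Measure.dirac_prod_dirac, smul_smul]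

lemma integrable_pointMasses_prod {E : Type*} [NormedAddCommGroup E] (f : ℝ × ℝ → E) :
    Integrable f ((pointMasses w p).prod (pointMasses w p)) := by
  rw [pointMasses_prod]
  refine integrable_finsetSum_measure.2 fun i _ => ?_
  exact (integrable_dirac (by simp)).smul_measure (ENNReal.mul_ne_top (by simp) (by simp))

lemma integral_pointMasses_prod (hw : ∀ i, 0 < w i) (f : ℝ × ℝ → ℂ) :
    ∫ q, f q ∂((pointMasses w p).prod (pointMasses w p)) =
      ∑ i, ∑ j, (w i : ℂ) * w j * f (p i, p j) := by
  rw [pointMasses_prod, integral_finsetSum_measure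
    fun i _ => (integrable_dirac (by simp)).smul_measure (ENNReal.mul_ne_top (by simp) (by simp)),
    Fintype.sum_prod_type]
  refine Finset.sum_congr rfl fun i _ => Finset.sum_congr rfl fun j _ => ?_
  rw [integral_smul_measure, integral_dirac, ENNReal.toReal_mul, ENNReal.toReal_ofReal (hw i).le,
    ENNReal.toReal_ofReal (hw j).le]
  simp

/-- Solutions of `-f''' = z g f` for a discrete mass distribution are the continuous piecewise
quadratic functions whose second derivative jumps by `-z m_j f(ξ_j)` at `ξ_j`. -/
theorem isSolution_iff (hw : ∀ i, 0 < w i) (z : ℂ) (f : ℝ → ℂ) :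
    IsSolution (pointMasses w p) z f ↔ ∃ a b c : ℂ, ∀ x : ℝ,
      f x = a + b * x + c * x ^ 2 / 2 - z * ∑ j, w j * f (p j) * kernel (p j) x := by
  have hkern : ∀ {η : ℝ → ℝ}, ContDiff ℝ ∞ η → HasCompactSupport η →
      Integrable (fun x => iteratedDeriv 3 η x • (z * ∑ j, w j * f (p j) * kernel (p j) x)) ∧
      ∫ x, iteratedDeriv 3 η x • (z * ∑ j, w j * f (p j) * kernel (p j) x) =
        -(z * ∑ j, w j * (η (p j) • f (p j))) := by
    intro η hη hηc
    have h3c := continuous_deriv3 hη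
    have h3s := hasCompactSupport_deriv3 hηc
    constructor
    · refine Continuous.integrable_of_hasCompactSupport ?_ h3s.smul_right
      have := fun j => continuous_kernel (p j)
      fun_prop
    · have hrw : ∀ x, iteratedDeriv 3 η x • (z * ∑ j, (w j : ℂ) * f (p j) * kernel (p j) x) =
          ∑ j, (z * (w j * f (p j))) * ((iteratedDeriv 3 η x * kernel (p j) x : ℝ) : ℂ) := by
        intro x
        rw [Complex.real_smul, Finset.mul_sum, Finset.mul_sum]
        refine Finset.sum_congr rfl fun j _ => ?_
        push_cast; ring
      simp_rw [hrw]
      rw [integral_finsetSum]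
      · rw [Finset.mul_sum, ← Finset.sum_neg_distrib]
        refine Finset.sum_congr rfl fun j _ => ?_
        rw [integral_const_mul, integral_complex_ofReal, integral_deriv3_mul_kernel hη hηc]
        simp only [Complex.real_smul]
        push_cast; ring
      · intro j _
        refine Continuous.integrable_of_hasCompactSupport ?_ ?_
        · have := continuous_kernel (p j)
          fun_prop
        · refine HasCompactSupport.mul_left ?_
          exact (h3s.mul_right (f' := kernel (p j))).comp_left (g := fun x : ℝ => (x : ℂ)) (by simp)
  constructor
  · rintro ⟨hc, hweak⟩
    -- Adding the kernel terms cancels the right-hand side of the weak equation.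
    obtain ⟨a, b, c, h⟩ := eq_quadratic_of_weak_deriv3_eq_zero
      (h := fun x => f x + z * ∑ j, w j * f (p j) * kernel (p j) x)
      (by have := fun j => continuous_kernel (p j); fun_prop) (by
        intro η hη hηc
        have h3c := continuous_deriv3 hη
        have h3s := hasCompactSupport_deriv3 hηc
        simp_rw [smul_add]
        have hi : Integrable (fun x => iteratedDeriv 3 η x • f x) :=
          (h3c.smul hc).integrable_of_hasCompactSupport h3s.smul_right
        rw [integral_add hi (hkern hη hηc).1, (hkern hη hηc).2, hweak η hη hηc, integral_pointMasses hw]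
        ring)
    refine ⟨a, b, 2 * c, fun x => ?_⟩
    linear_combination h x
  · rintro ⟨a, b, c, h⟩
    have hfun : f = fun x : ℝ => a + b * x + c * x ^ 2 / 2
        - z * ∑ j, w j * f (p j) * kernel (p j) x := funext h
    have hcont : Continuous f := by
      rw [hfun]
      have := fun j => continuous_kernel (p j)
      fun_prop
    refine ⟨hcont, fun η hη hηc => ?_⟩
    have h3c := continuous_deriv3 hη
    have h3s := hasCompactSupport_deriv3 hηc
    have hq : ∫ x, iteratedDeriv 3 η x • (a + b * x + c * x ^ 2 / 2 : ℂ) = 0 := by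
      have hm : ∀ α β γ : ℝ,
          Integrable (fun x => ((iteratedDeriv 3 η x * (α + β * x + γ * x ^ 2 / 2) : ℝ) : ℂ)) ∧
          ∫ x, ((iteratedDeriv 3 η x * (α + β * x + γ * x ^ 2 / 2) : ℝ) : ℂ) = 0 := by
        intro α β γ
        constructor
        · refine Continuous.integrable_of_hasCompactSupport (by fun_prop) ?_
          exact (h3s.mul_right (f' := fun x => α + β * x + γ * x ^ 2 / 2)).comp_left
            (g := fun x : ℝ => (x : ℂ)) (by simp)
        · rw [integral_complex_ofReal, integral_deriv3_mul_quadratic hη hηc, Complex.ofReal_zero]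
      -- Splitting the coefficients into real and imaginary parts reduces the claim to real
      -- quadratics.
      have hsplit : ∀ x : ℝ, iteratedDeriv 3 η x • (a + b * x + c * x ^ 2 / 2 : ℂ) =
          ((iteratedDeriv 3 η x * (a.re + b.re * x + c.re * x ^ 2 / 2) : ℝ) : ℂ) +
          Complex.I * ((iteratedDeriv 3 η x * (a.im + b.im * x + c.im * x ^ 2 / 2) : ℝ) : ℂ) := by
        intro x
        rw [Complex.real_smul]
        nth_rewrite 1 [← Complex.re_add_im a, ← Complex.re_add_im b, ← Complex.re_add_im c]
        push_cast; ring
      simp_rw [hsplit]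
      rw [integral_add (hm _ _ _).1 ((hm _ _ _).1.const_mul _), (hm _ _ _).2, integral_const_mul,
        (hm _ _ _).2]
      simp
    have hqi : Integrable (fun x : ℝ => iteratedDeriv 3 η x • (a + b * x + c * x ^ 2 / 2 : ℂ)) :=
      Continuous.integrable_of_hasCompactSupport (by fun_prop) h3s.smul_right
    calc ∫ x, iteratedDeriv 3 η x • f x
        = ∫ x : ℝ, (iteratedDeriv 3 η x • (a + b * x + c * x ^ 2 / 2 : ℂ) -
            iteratedDeriv 3 η x • (z * ∑ j, w j * f (p j) * kernel (p j) x)) := by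
          congr 1; ext x; rw [← smul_sub, ← h x]
      _ = z * ∑ j, w j * (η (p j) • f (p j)) := by
          rw [integral_sub hqi (hkern hη hηc).1, hq, (hkern hη hηc).2]; ring
      _ = _ := by rw [integral_pointMasses hw]

end PointMasses

/-! ### Partial fractions of the Weyl functions -/

/-- P equals its Lagrange interpolant at the zeros of Q, and the nodal weights are the reciprocals
of the derivative of the nodal polynomial at the nodes. -/
lemma partial_fractions {F : Type*} [Field F] {N : ℕ} {P Q : Polynomial F} {v : ℕ → F} {e : F}
    (hv : Set.InjOn v (Finset.range N)) (hP : P.degree < N)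
    (hQ : Q = Polynomial.C e * Lagrange.nodal (Finset.range N) v) {x : F}
    (hx : ∀ i ∈ Finset.range N, x ≠ v i) :
    P.eval x / Q.eval x =
      ∑ i ∈ Finset.range N, P.eval (v i) / (Polynomial.derivative Q).eval (v i) * (1 / (x - v i)) := by
  have h1 := Lagrange.eq_interpolate hv (f := P) (by simpa using hP)
  have h2 := Lagrange.eval_interpolate_not_at_node (fun i => P.eval (v i)) hx
  rw [← h1] at h2
  have hn : (Lagrange.nodal (Finset.range N) v).eval x ≠ 0 := Lagrange.eval_nodal_not_at_node hx
  rw [h2, hQ, Polynomial.eval_mul, Polynomial.eval_C, mul_comm e, mul_div_mul_left _ _ hn,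
    Finset.sum_div]
  refine Finset.sum_congr rfl fun i hi => ?_
  rw [Lagrange.nodalWeight_eq_eval_derivative_nodal hi, Polynomial.derivative_C_mul,
    Polynomial.eval_mul, Polynomial.eval_C, one_div, div_eq_mul_inv, div_eq_mul_inv, mul_inv]
  ring

open Polynomial in
theorem IsStieltjes.deriv_sign {N : ℕ} {A B D : ℝ[X]} {y : ℕ → ℝ} {e : ℝ}
    (h : IsStieltjes N A B D y e) {i : ℕ} (hi : i < N) :
    (-1) ^ i * (derivative D).eval (y i) < 0 := by
  have := deriv_nodal_sign hi y e h.sign h.lt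
  rw [h.eq_nodal]
  simpa using this

/-- The weights of the spectral measure. -/
noncomputable def weight (B D : Polynomial ℝ) (y : ℕ → ℝ) (i : ℕ) : ℝ :=
  -B.eval (y i) / (Polynomial.derivative D).eval (y i)

open Polynomial in
theorem IsStieltjes.weight_pos {N : ℕ} {A B D : ℝ[X]} {y : ℕ → ℝ} {e : ℝ}
    (h : IsStieltjes N A B D y e) {i : ℕ} (hi : i < N) : 0 < weight B D y i := by
  have h1 := h.deriv_sign hi
  have h2 := h.sign_snd i hi
  have h3 : weight B D y i =
      ((-1) ^ i * B.eval (y i)) / -((-1) ^ i * (derivative D).eval (y i)) := by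
    rw [weight, div_neg, mul_div_mul_left _ _ (by simp), neg_div]
  rw [h3]
  exact div_pos h2 (by linarith)

open Polynomial in
theorem IsStieltjes.injOn {N : ℕ} {A B D : ℝ[X]} {y : ℕ → ℝ} {e : ℝ}
    (h : IsStieltjes N A B D y e) : Set.InjOn y (Finset.range N) := by
  intro i hi j hj hij
  simp only [Finset.coe_range, Set.mem_Iio] at hi hj
  rcases lt_trichotomy i j with h1 | h1 | h1
  · exact absurd hij (h.lt i j h1 hj).ne
  · exact h1
  · exact absurd hij (h.lt j i h1 hi).ne'

open Polynomial in
theorem IsStieltjes.aeval_eq_zero_iff {N : ℕ} {A B D : ℝ[X]} {y : ℕ → ℝ} {e : ℝ}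
    (h : IsStieltjes N A B D y e) (z : ℂ) : aeval z D = 0 ↔ ∃ i < N, z = y i := by
  have he : e ≠ 0 := by rintro rfl; simpa using h.sign
  rw [h.eq_nodal]
  simp only [map_mul, aeval_C, Complex.coe_algebraMap, mul_eq_zero, Complex.ofReal_eq_zero, he,
    false_or, Lagrange.nodal, map_prod, map_sub, aeval_X, Finset.prod_eq_zero_iff, sub_eq_zero,
    Finset.mem_range]

open Polynomial in
theorem IsStieltjes.partial_fractions_complex {N : ℕ} {A B D : ℝ[X]} {y : ℕ → ℝ} {e : ℝ}
    (h : IsStieltjes N A B D y e) {P : ℝ[X]} (hP : P.degree < N) {z : ℂ} (hz : aeval z D ≠ 0) :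
    aeval z P / aeval z D = ∑ i ∈ Finset.range N,
      ((P.eval (y i) / (derivative D).eval (y i) : ℝ) : ℂ) * (1 / (z - y i)) := by
  have he : e ≠ 0 := by rintro rfl; simpa using h.sign
  have hq : D.map Complex.ofRealHom = C (e : ℂ) *
      Lagrange.nodal (Finset.range N) (fun i => (y i : ℂ)) := by
    rw [h.eq_nodal]
    simp [Lagrange.nodal, Polynomial.map_prod]
  have hev : ∀ (Q : ℝ[X]) (x : ℝ), (Q.map Complex.ofRealHom).eval (x : ℂ) = (Q.eval x : ℝ) := by
    intro Q x
    exact Polynomial.eval_map_apply Complex.ofRealHom x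
  have := partial_fractions (P := P.map Complex.ofRealHom) (x := z)
    (fun i hi j hj hij => h.injOn hi hj (by exact_mod_cast hij))
    (by rwa [degree_map]) hq (fun i hi hzi => hz
      ((h.aeval_eq_zero_iff z).2 ⟨i, Finset.mem_range.1 hi, hzi⟩))
  have hae : ∀ Q : ℝ[X], aeval z Q = (Q.map Complex.ofRealHom).eval z := by
    intro Q
    rw [aeval_def, eval_map]; rfl
  rw [hae, hae, this]
  refine Finset.sum_congr rfl fun i _ => ?_
  rw [derivative_map, hev, hev]
  push_cast
  rfl

open Polynomial in
theorem IsStieltjes.weyl_snd {N : ℕ} {A B D : ℝ[X]} {y : ℕ → ℝ} {e : ℝ}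
    (h : IsStieltjes N A B D y e) {z : ℂ} (hz : aeval z D ≠ 0) :
    -aeval z B / aeval z D = ∑ i ∈ Finset.range N, (weight B D y i : ℂ) * (1 / (z - y i)) := by
  rw [neg_div, h.partial_fractions_complex h.deg_snd hz, ← Finset.sum_neg_distrib]
  refine Finset.sum_congr rfl fun i _ => ?_
  rw [weight]; push_cast; ring

open Polynomial in
-- By the concomitant at y j, the residue of -A/D there is `weight j` times B(-y j)/D(-y j); the
-- second factor is expanded by `weyl_snd`, which produces the denominators y i + y j.
theorem IsStieltjes.weyl_fst {N : ℕ} {A B D : ℝ[X]} {y : ℕ → ℝ} {e : ℝ}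
    (h : IsStieltjes N A B D y e) {z : ℂ} (hz : aeval z D ≠ 0) :
    -aeval z A / aeval z D = ∑ i ∈ Finset.range N, ∑ j ∈ Finset.range N,
      (weight B D y i : ℂ) * weight B D y j * (1 / ((z - y j) * (y i + y j))) := by
  rw [neg_div, h.partial_fractions_complex h.deg_fst hz, ← Finset.sum_neg_distrib, Finset.sum_comm]
  refine Finset.sum_congr rfl fun j hj => ?_
  have hj' := Finset.mem_range.1 hj
  have hyj := h.pos j hj'
  have hneg := (h.thd_neg _ hyj).ne'
  have hev : ∀ (Q : ℝ[X]) (x : ℝ), aeval (x : ℂ) Q = ((Q.eval x : ℝ) : ℂ) := fun Q x =>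
    aeval_algebraMap_apply_eq_algebraMap_eval x Q
  have hDj : D.eval (y j) = 0 := by
    have := (h.aeval_eq_zero_iff (y j)).2 ⟨j, hj', rfl⟩
    rw [hev] at this
    exact_mod_cast this
  have hd : (derivative D).eval (y j) ≠ 0 := by
    intro h0
    have := h.deriv_sign hj'
    rw [h0] at this
    simp at this
  -- The point -y j is admissible because D is positive on the negative axis.
  have hw := h.weyl_snd (z := ((-y j : ℝ) : ℂ)) (by rw [hev]; exact_mod_cast hneg)
  rw [hev, hev] at hw
  have hc := h.concomitant (y j)
  rw [hDj, mul_zero, add_zero] at hc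
  have hres : -(A.eval (y j) / (derivative D).eval (y j))
      = weight B D y j * (B.eval (-y j) / D.eval (-y j)) := by
    rw [weight]
    field_simp
    linear_combination -hc
  have hsum : ((B.eval (-y j) / D.eval (-y j) : ℝ) : ℂ) =
      ∑ i ∈ Finset.range N, (weight B D y i : ℂ) * (1 / ((y i : ℂ) + y j)) := by
    have h1 : ((B.eval (-y j) / D.eval (-y j) : ℝ) : ℂ) =
        -(-((B.eval (-y j) : ℝ) : ℂ) / ((D.eval (-y j) : ℝ) : ℂ)) := by push_cast; ring
    rw [h1, hw, ← Finset.sum_neg_distrib]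
    refine Finset.sum_congr rfl fun i _ => ?_
    have h2 : ((-y j : ℝ) : ℂ) - y i = -((y i : ℂ) + y j) := by push_cast; ring
    rw [h2, one_div_neg_eq_neg_one_div]
    ring
  calc -(((A.eval (y j) / (derivative D).eval (y j) : ℝ) : ℂ) * (1 / (z - y j)))
      = ((-(A.eval (y j) / (derivative D).eval (y j)) : ℝ) : ℂ) * (1 / (z - y j)) := by
        push_cast; ring
    _ = weight B D y j * (∑ i ∈ Finset.range N, (weight B D y i : ℂ) * (1 / ((y i : ℂ) + y j)))
          * (1 / (z - y j)) := by rw [hres, Complex.ofReal_mul, hsum]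
    _ = _ := by
        rw [Finset.mul_sum, Finset.sum_mul]
        refine Finset.sum_congr rfl fun i _ => ?_
        rw [one_div, one_div, one_div, mul_inv]
        ring

/-! ### The string -/

lemma hasDerivAt_quadratic (a b c : ℂ) (x : ℝ) :
    HasDerivAt (fun x : ℝ => a + b * x + c * (x : ℂ) ^ 2 / 2) (b + c * x) x := by
  have hx := Complex.ofRealCLM.hasDerivAt (x := x)
  have := ((hx.const_mul b).const_add a).add (((hx.pow 2).const_mul c).div_const 2)
  refine this.congr_deriv ?_
  simp
  ring

lemma iteratedDeriv_quadratic (a b c : ℂ) :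
    iteratedDeriv 1 (fun x : ℝ => a + b * x + c * (x : ℂ) ^ 2 / 2) = (fun x : ℝ => b + c * x) ∧
    iteratedDeriv 2 (fun x : ℝ => a + b * x + c * (x : ℂ) ^ 2 / 2) = fun _ => c := by
  have h1 : iteratedDeriv 1 (fun x : ℝ => a + b * x + c * (x : ℂ) ^ 2 / 2) =
      fun x : ℝ => b + c * x := by
    rw [iteratedDeriv_one]
    exact funext fun x => (hasDerivAt_quadratic a b c x).deriv
  refine ⟨h1, ?_⟩
  rw [iteratedDeriv_succ, h1]
  ext x
  simpa using (hasDerivAt_quadratic b c 0 x).deriv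

lemma tendsto_iteratedDeriv_of_eq_quadratic {f : ℝ → ℂ} {a b c : ℂ} {s : ℝ}
    (hf : ∀ x > s, f x = a + b * x + c * (x : ℂ) ^ 2 / 2) :
    Tendsto (iteratedDeriv 0 f) (𝓝[>] s) (𝓝 (a + b * s + c * s ^ 2 / 2)) ∧
    Tendsto (iteratedDeriv 1 f) (𝓝[>] s) (𝓝 (b + c * s)) ∧
    Tendsto (iteratedDeriv 2 f) (𝓝[>] s) (𝓝 c) := by
  set g : ℝ → ℂ := fun x => a + b * x + c * (x : ℂ) ^ 2 / 2 with hg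
  have he : ∀ k, iteratedDeriv k g =ᶠ[𝓝[>] s] iteratedDeriv k f := by
    intro k
    filter_upwards [self_mem_nhdsWithin] with x hx
    refine Filter.EventuallyEq.iteratedDeriv_eq k ?_
    filter_upwards [isOpen_Ioi.mem_nhds hx] with t ht
    exact (hf t ht).symm
  have hcont : ∀ {u : ℝ → ℂ}, Continuous u → Tendsto u (𝓝[>] s) (𝓝 (u s)) := fun hu =>
    hu.continuousAt.mono_left nhdsWithin_le_nhds
  refine ⟨Tendsto.congr' (he 0) ?_, Tendsto.congr' (he 1) ?_, Tendsto.congr' (he 2) ?_⟩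
  · rw [iteratedDeriv_zero]
    exact hcont (u := g) (by fun_prop)
  · rw [(iteratedDeriv_quadratic a b c).1]
    exact hcont (u := fun x : ℝ => b + c * x) (by fun_prop)
  · rw [(iteratedDeriv_quadratic a b c).2]
    exact tendsto_const_nhds

/-! ### Transfer polynomials as values of the solution -/

section Transfer

open Polynomial

/-- Closed form of the transfer recursion for masses `m j` at the positions `pos (j + 1)`. -/
lemma aeval_transfer (pos m : ℕ → ℝ) (h0 : pos 0 = 0) (z : ℂ) (k : ℕ) :
    let T := transfer (fun k => pos (k + 1) - pos k) m
    aeval z (T k).1 = pos k ^ 2 / 2 - z * ∑ j ∈ Finset.range k,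
      m j * aeval z (T (j + 1)).1 * ((pos k - pos (j + 1)) ^ 2 / 2) ∧
    aeval z (T k).2.1 = pos k - z * ∑ j ∈ Finset.range k,
      m j * aeval z (T (j + 1)).1 * (pos k - pos (j + 1)) ∧
    aeval z (T k).2.2 = 1 - z * ∑ j ∈ Finset.range k, m j * aeval z (T (j + 1)).1 := by
  intro T
  induction k with
  | zero => simp [T, transfer, h0]
  | succ k ih =>
    obtain ⟨hA, hB, hD⟩ := ih
    have e1 : aeval z (T (k + 1)).1 = aeval z (T k).1 + (pos (k + 1) - pos k) * aeval z (T k).2.1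
        + (pos (k + 1) - pos k) ^ 2 / 2 * aeval z (T k).2.2 := by
      simp [T, transfer]
    have e2 : aeval z (T (k + 1)).2.1 = aeval z (T k).2.1
        + (pos (k + 1) - pos k) * aeval z (T k).2.2 := by
      simp [T, transfer]
    have e3 : aeval z (T (k + 1)).2.2 = aeval z (T k).2.2 - m k * z * aeval z (T (k + 1)).1 := by
      simp [T, transfer]
    refine ⟨?_, ?_, ?_⟩
    -- The newly added mass contributes nothing to the value at its own position.
    · rw [Finset.sum_range_succ, sub_self, e1, hA, hB, hD]
      have : ∑ j ∈ Finset.range k, (m j : ℂ) * aeval z (T (j + 1)).1 *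
            (((pos (k + 1) : ℂ) - pos (j + 1)) ^ 2 / 2) =
          ∑ j ∈ Finset.range k, (m j : ℂ) * aeval z (T (j + 1)).1 *
            (((pos k : ℂ) - pos (j + 1)) ^ 2 / 2) + (pos (k + 1) - pos k) *
          ∑ j ∈ Finset.range k, (m j : ℂ) * aeval z (T (j + 1)).1 * ((pos k : ℂ) - pos (j + 1)) +
          (pos (k + 1) - pos k) ^ 2 / 2 *
          ∑ j ∈ Finset.range k, (m j : ℂ) * aeval z (T (j + 1)).1 := by
        rw [Finset.mul_sum, Finset.mul_sum, ← Finset.sum_add_distrib, ← Finset.sum_add_distrib]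
        refine Finset.sum_congr rfl fun j _ => ?_
        ring
      rw [this]
      ring
    · rw [Finset.sum_range_succ, sub_self, e2, hB, hD]
      have : ∑ j ∈ Finset.range k, (m j : ℂ) * aeval z (T (j + 1)).1 *
            ((pos (k + 1) : ℂ) - pos (j + 1)) =
          ∑ j ∈ Finset.range k, (m j : ℂ) * aeval z (T (j + 1)).1 * ((pos k : ℂ) - pos (j + 1)) +
          (pos (k + 1) - pos k) *
          ∑ j ∈ Finset.range k, (m j : ℂ) * aeval z (T (j + 1)).1 := by
        rw [Finset.mul_sum, ← Finset.sum_add_distrib]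
        refine Finset.sum_congr rfl fun j _ => ?_
        ring
      rw [this]
      ring
    · rw [Finset.sum_range_succ, e3, hD]
      ring

end Transfer

/-- The positions of the masses, preceded by the left end `0` of the string. -/
noncomputable def position {N : ℕ} (p : Fin N → ℝ) : ℕ → ℝ
  | 0 => 0
  | i + 1 => if h : i < N then p ⟨i, h⟩ else 0

/-- The masses, as a sequence. -/
noncomputable def massSeq {N : ℕ} (w : Fin N → ℝ) (i : ℕ) : ℝ := if h : i < N then w ⟨i, h⟩ else 0

/-- The polynomials `φ`, `φ'`, `φ''` just after the first `k` masses. -/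
noncomputable def stringPoly {N : ℕ} (w p : Fin N → ℝ) :
    ℕ → Polynomial ℝ × Polynomial ℝ × Polynomial ℝ :=
  transfer (fun k => position p (k + 1) - position p k) (massSeq w)

section

variable {N : ℕ} {w p : Fin N → ℝ}

@[simp] lemma position_succ (i : Fin N) : position p (i + 1) = p i := by simp [position]

@[simp] lemma massSeq_val (i : Fin N) : massSeq w i = w i := by simp [massSeq]

/-- For x between consecutive masses only those to the left act, and on them the positive part in
`kernel` can be dropped. -/
lemma sum_kernel (G : ℕ → ℂ) {k : ℕ} (hk : k ≤ N) {x : ℝ} (h1 : ∀ j : Fin N, j < k → p j ≤ x)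
    (h2 : ∀ j : Fin N, k ≤ j → x ≤ p j) :
    ∑ j : Fin N, (w j : ℂ) * G j * kernel (p j) x =
      ∑ j ∈ Finset.range k, (massSeq w j : ℂ) * G j * (((x : ℂ) - position p (j + 1)) ^ 2 / 2) := by
  have e1 : ∑ j : Fin N, (w j : ℂ) * G j * kernel (p j) x =
      ∑ j ∈ Finset.range N, (massSeq w j : ℂ) * G j * kernel (position p (j + 1)) x := by
    rw [← Fin.sum_univ_eq_sum_range
      (fun j => (massSeq w j : ℂ) * G j * kernel (position p (j + 1)) x)]
    simp
  rw [e1]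
  symm
  rw [← Finset.sum_subset (Finset.range_mono hk)]
  · refine Finset.sum_congr rfl fun j hj => ?_
    have hjk := Finset.mem_range.1 hj
    have := h1 ⟨j, hjk.trans_le hk⟩ hjk
    rw [← position_succ (p := p) ⟨j, hjk.trans_le hk⟩] at this
    rw [kernel_of_ge this]
    push_cast
    rfl
  · intro j hj hjk
    have hjN := Finset.mem_range.1 hj
    have := h2 ⟨j, hjN⟩ (by simpa using hjk)
    rw [← position_succ (p := p) ⟨j, hjN⟩] at this
    rw [kernel_of_le this]
    simp

open Polynomial in
lemma aeval_stringPoly_fst (hp : StrictMono p) (z : ℂ) (i : Fin N) :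
    aeval z (stringPoly w p (i + 1)).1 = (p i : ℂ) ^ 2 / 2 - z * ∑ j : Fin N,
      w j * aeval z (stringPoly w p (j + 1)).1 * kernel (p j) (p i) := by
  have h := (aeval_transfer (position p) (massSeq w) rfl z (i + 1)).1
  -- The term of mass i itself vanishes, leaving the masses strictly to its left.
  rw [Finset.sum_range_succ, sub_self, position_succ] at h
  rw [sum_kernel (fun j => aeval z (stringPoly w p (j + 1)).1) i.2.le
    (fun j hj => (hp (Fin.lt_def.2 hj)).le) (fun j hj => hp.monotone (Fin.le_def.2 hj))]
  refine h.trans ?_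
  simp [stringPoly]

open Polynomial in
-- A kernel vanishes at its own mass and to the left of it, so the implicit equation for f at p i
-- involves only earlier masses and is solved by strong induction.
lemma value_eq (hp : StrictMono p) {z c : ℂ} {f : ℝ → ℂ} (hf : ∀ x : ℝ,
    f x = c * x ^ 2 / 2 - z * ∑ j, w j * f (p j) * kernel (p j) x) (i : Fin N) :
    f (p i) = c * aeval z (stringPoly w p (i + 1)).1 := by
  induction i using WellFoundedLT.induction with
  | ind i ih =>
    have h : ∑ j, w j * f (p j) * kernel (p j) (p i) = c * ∑ j : Fin N,
        w j * aeval z (stringPoly w p (j + 1)).1 * kernel (p j) (p i) := by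
      rw [Finset.mul_sum]
      refine Finset.sum_congr rfl fun j _ => ?_
      rcases lt_or_ge j i with hj | hj
      · rw [ih j hj]; ring
      · rw [kernel_of_le (hp.monotone hj)]; simp
    rw [hf, aeval_stringPoly_fst hp, h]
    ring

open Polynomial in
lemma eq_of_form (hp : StrictMono p) {z c : ℂ} {f : ℝ → ℂ} (hf : ∀ x : ℝ,
    f x = c * x ^ 2 / 2 - z * ∑ j, w j * f (p j) * kernel (p j) x) (x : ℝ) :
    f x = c * ((x : ℂ) ^ 2 / 2 -
      z * ∑ j : Fin N, w j * aeval z (stringPoly w p (j + 1)).1 * kernel (p j) x) := by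
  have h : ∑ j, w j * f (p j) * kernel (p j) x = c * ∑ j : Fin N,
      w j * aeval z (stringPoly w p (j + 1)).1 * kernel (p j) x := by
    rw [Finset.mul_sum]
    refine Finset.sum_congr rfl fun j _ => ?_
    rw [value_eq hp hf j]; ring
  rw [hf, h]
  ring

/-- There is no mass near 0, so the initial data of f can be read off as a, b, c. -/
lemma eventually_eq_quadratic (hp0 : ∀ i, 0 < p i) {z a b c : ℂ} {f : ℝ → ℂ} (hf : ∀ x : ℝ,
    f x = a + b * x + c * x ^ 2 / 2 - z * ∑ j, w j * f (p j) * kernel (p j) x) :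
    f =ᶠ[𝓝 0] fun x : ℝ => a + b * x + c * (x : ℂ) ^ 2 / 2 := by
  have h : ∀ᶠ x : ℝ in 𝓝 0, ∀ i, x < p i :=
    eventually_all.2 fun i => eventually_lt_nhds (hp0 i)
  filter_upwards [h] with x hx
  rw [hf, Finset.sum_eq_zero fun j _ => by rw [kernel_of_le (hx j).le]; simp]
  simp

lemma hasDerivAt_deriv_of_eventuallyEq {a b c : ℂ} {f : ℝ → ℂ}
    (h : f =ᶠ[𝓝 0] fun x : ℝ => a + b * x + c * (x : ℂ) ^ 2 / 2) :
    HasDerivAt f b 0 ∧ HasDerivAt (deriv f) c 0 := by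
  constructor
  · have := (hasDerivAt_quadratic a b c 0).congr_of_eventuallyEq h
    simpa using this
  · have h1 : deriv f =ᶠ[𝓝 0] fun x : ℝ => b + c * x + 0 * (x : ℂ) ^ 2 / 2 := by
      filter_upwards [h.deriv] with x hx
      rw [hx, (hasDerivAt_quadratic a b c x).deriv]
      simp
    have := (hasDerivAt_quadratic b c 0 0).congr_of_eventuallyEq h1
    simpa using this

theorem IsSolution.exists_form (hw : ∀ i, 0 < w i) (hp0 : ∀ i, 0 < p i) {z : ℂ} {f : ℝ → ℂ}
    (h : IsSolution (pointMasses w p) z f) (h0 : f 0 = 0) (h1 : HasDerivAt f 0 0) :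
    ∃ c, HasDerivAt (deriv f) c 0 ∧
      ∀ x : ℝ, f x = c * x ^ 2 / 2 - z * ∑ j, w j * f (p j) * kernel (p j) x := by
  obtain ⟨a, b, c, hf⟩ := (isSolution_iff hw z f).1 h
  have he := eventually_eq_quadratic hp0 hf
  have ha : a = 0 := by
    have := he.eq_of_nhds
    simpa [h0] using this.symm
  obtain ⟨hd1, hd2⟩ := hasDerivAt_deriv_of_eventuallyEq he
  have hb : b = 0 := hd1.unique h1
  refine ⟨c, hd2, fun x => ?_⟩
  rw [hf x, ha, hb]
  ring

theorem isIVPSolution_iff (hw : ∀ i, 0 < w i) (hp0 : ∀ i, 0 < p i) {z : ℂ} {f : ℝ → ℂ} :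
    IsIVPSolution (pointMasses w p) z f ↔
      ∀ x : ℝ, f x = 1 * x ^ 2 / 2 - z * ∑ j, w j * f (p j) * kernel (p j) x := by
  constructor
  · intro h
    obtain ⟨c, hc, hf⟩ := h.toIsSolution.exists_form hw hp0 h.val_zero h.deriv_zero
    rwa [hc.unique h.deriv2_zero] at hf
  · intro hf
    have hf' : ∀ x : ℝ, f x = 0 + 0 * x + 1 * x ^ 2 / 2
        - z * ∑ j, w j * f (p j) * kernel (p j) x := by
      intro x; rw [zero_mul, zero_add, zero_add]; exact hf x
    have he := eventually_eq_quadratic hp0 hf'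
    obtain ⟨hd1, hd2⟩ := hasDerivAt_deriv_of_eventuallyEq he
    refine ⟨(isSolution_iff hw z f).2 ⟨0, 0, 1, hf'⟩, ?_, hd1, hd2⟩
    simpa using he.eq_of_nhds

open Polynomial in
theorem existsUnique_isIVPSolution (hw : ∀ i, 0 < w i) (hp0 : ∀ i, 0 < p i) (hp : StrictMono p)
    (z : ℂ) : ∃! f : ℝ → ℂ, IsIVPSolution (pointMasses w p) z f := by
  refine ⟨fun x : ℝ => 1 * ((x : ℂ) ^ 2 / 2 -
      z * ∑ j : Fin N, w j * aeval z (stringPoly w p (j + 1)).1 * kernel (p j) x),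
    (isIVPSolution_iff hw hp0).2 fun x => ?_, fun g hg => ?_⟩
  · simp only [← aeval_stringPoly_fst hp z, one_mul]
  · ext x
    exact eq_of_form hp ((isIVPSolution_iff hw hp0).1 hg) x

open Polynomial in
theorem tendsto_end {p : Fin (N + 1) → ℝ} {w : Fin (N + 1) → ℝ} (hp : StrictMono p) {z c : ℂ}
    {f : ℝ → ℂ} (hf : ∀ x : ℝ,
      f x = c * x ^ 2 / 2 - z * ∑ j, w j * f (p j) * kernel (p j) x) :
    Tendsto (iteratedDeriv 0 f) (𝓝[>] (p (Fin.last N)))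
      (𝓝 (c * aeval z (stringPoly w p (N + 1)).1)) ∧
    Tendsto (iteratedDeriv 1 f) (𝓝[>] (p (Fin.last N)))
      (𝓝 (c * aeval z (stringPoly w p (N + 1)).2.1)) ∧
    Tendsto (iteratedDeriv 2 f) (𝓝[>] (p (Fin.last N)))
      (𝓝 (c * aeval z (stringPoly w p (N + 1)).2.2)) := by
  set s := p (Fin.last N) with hs
  let q : ℕ → ℂ := fun j => massSeq w j * aeval z (stringPoly w p (j + 1)).1
  let t : ℕ → ℂ := fun j => position p (j + 1)
  -- Beyond the last mass every kernel is a full quadratic; expanding in powers of x exposes the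
  -- right-hand limits.
  have hquad : ∀ x > s, f x = -(c * z * ∑ j ∈ Finset.range (N + 1), q j * (t j ^ 2 / 2)) +
      (c * z * ∑ j ∈ Finset.range (N + 1), q j * t j) * x +
      (c * (1 - z * ∑ j ∈ Finset.range (N + 1), q j)) * (x : ℂ) ^ 2 / 2 := by
    intro x hx
    rw [eq_of_form hp hf, sum_kernel (fun j => aeval z (stringPoly w p (j + 1)).1) le_rfl
      (fun j _ => (hp.monotone (Fin.le_last j)).trans hx.le) (fun j hj => absurd j.2 (by omega))]
    have : ∑ j ∈ Finset.range (N + 1), (massSeq w j : ℂ) * aeval z (stringPoly w p (j + 1)).1 *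
        (((x : ℂ) - position p (j + 1)) ^ 2 / 2) =
        (∑ j ∈ Finset.range (N + 1), q j) * (x ^ 2 / 2) -
        (∑ j ∈ Finset.range (N + 1), q j * t j) * x +
        ∑ j ∈ Finset.range (N + 1), q j * (t j ^ 2 / 2) := by
      rw [Finset.sum_mul, Finset.sum_mul, ← Finset.sum_sub_distrib, ← Finset.sum_add_distrib]
      refine Finset.sum_congr rfl fun j _ => ?_
      simp only [q, t]
      ring
    rw [this]
    ring
  obtain ⟨hA, hB, hD⟩ := aeval_transfer (position p) (massSeq w) rfl z (N + 1)
  have hpos : position p (N + 1) = s := position_succ (Fin.last N)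
  rw [hpos] at hA hB
  have hlim := tendsto_iteratedDeriv_of_eq_quadratic hquad
  refine ⟨?_, ?_, ?_⟩
  · convert hlim.1 using 2
    refine (congrArg (c * ·) hA).trans ?_
    have : ∑ j ∈ Finset.range (N + 1), (massSeq w j : ℂ) * aeval z (stringPoly w p (j + 1)).1 *
        (((s : ℂ) - position p (j + 1)) ^ 2 / 2) =
        (∑ j ∈ Finset.range (N + 1), q j) * (s ^ 2 / 2) -
        (∑ j ∈ Finset.range (N + 1), q j * t j) * s +
        ∑ j ∈ Finset.range (N + 1), q j * (t j ^ 2 / 2) := by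
      rw [Finset.sum_mul, Finset.sum_mul, ← Finset.sum_sub_distrib, ← Finset.sum_add_distrib]
      refine Finset.sum_congr rfl fun j _ => ?_
      simp only [q, t]
      ring
    refine (congrArg (fun u => c * ((s : ℂ) ^ 2 / 2 - z * u)) this).trans ?_
    ring
  · convert hlim.2.1 using 2
    refine (congrArg (c * ·) hB).trans ?_
    have : ∑ j ∈ Finset.range (N + 1), (massSeq w j : ℂ) * aeval z (stringPoly w p (j + 1)).1 *
        ((s : ℂ) - position p (j + 1)) =
        (∑ j ∈ Finset.range (N + 1), q j) * s - ∑ j ∈ Finset.range (N + 1), q j * t j := by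
      rw [Finset.sum_mul, ← Finset.sum_sub_distrib]
      refine Finset.sum_congr rfl fun j _ => ?_
      simp only [q, t]
      ring
    refine (congrArg (fun u => c * ((s : ℂ) - z * u)) this).trans ?_
    ring
  · convert hlim.2.2 using 2
    exact congrArg (c * ·) hD

theorem exists_isStieltjes_stringPoly (hw : ∀ i, 0 < w i) (hp0 : ∀ i, 0 < p i)
    (hp : StrictMono p) : ∃ y e, IsStieltjes N (stringPoly w p N).1 (stringPoly w p N).2.1
      (stringPoly w p N).2.2 y e := by
  refine exists_isStieltjes_transfer N (fun k hk => ?_) (fun k hk => ?_)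
  · have h1 := position_succ (p := p) ⟨k, hk⟩
    rcases k with _ | k
    · simp only [h1]
      simpa [position] using hp0 ⟨0, hk⟩
    · have h2 := position_succ (p := p) ⟨k, by omega⟩
      simp only at h1 h2
      rw [h1, h2, sub_pos]
      exact hp (Fin.mk_lt_mk.2 (Nat.lt_succ_self k))
  · have := massSeq_val (w := w) ⟨k, hk⟩
    simp only at this
    rw [this]
    exact hw _

open Polynomial in
-- A solution with f(0) = f'(0) = 0 is c times the solution of the initial value problem, with c ≠ 0
-- if it is nonzero, so its second derivative at the end is c D(z).
theorem spectrumType2_eq {p w : Fin (N + 1) → ℝ} (hw : ∀ i, 0 < w i) (hp0 : ∀ i, 0 < p i)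
    (hp : StrictMono p) (hp1 : p (Fin.last N) = 1) :
    spectrumType2 (pointMasses w p) = {z | aeval z (stringPoly w p (N + 1)).2.2 = 0} := by
  ext z
  constructor
  · rintro ⟨f, hf, hne, h0, h1, hlim⟩
    obtain ⟨c, -, hform⟩ := hf.exists_form hw hp0 h0 h1
    have ht := (tendsto_end hp hform).2.2
    rw [hp1] at ht
    have hc : c ≠ 0 := by
      rintro rfl
      refine hne (funext fun x => ?_)
      rw [eq_of_form hp hform x, zero_mul]
      rfl
    exact (mul_eq_zero.1 (tendsto_nhds_unique ht hlim)).resolve_left hc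
  · intro hz
    obtain ⟨f, hf, -⟩ := existsUnique_isIVPSolution hw hp0 hp z
    have ht := (tendsto_end hp ((isIVPSolution_iff hw hp0).1 hf)).2.2
    rw [hp1, show aeval z (stringPoly w p (N + 1)).2.2 = 0 from hz, mul_zero] at ht
    refine ⟨f, hf.toIsSolution, ?_, hf.val_zero, hf.deriv_zero, ht⟩
    rintro rfl
    have h2 := hf.deriv2_zero
    have h3 : deriv (0 : ℝ → ℂ) = fun _ => 0 := by ext x; simp
    rw [h3] at h2
    exact one_ne_zero (h2.unique (hasDerivAt_const 0 0))

end

end CubicString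

/-! ### Spectral representation of the Weyl functions -/

theorem mainTheorem4 (n : ℕ) (m ξ : Fin (n + 1) → ℝ) (hm : ∀ i, 0 < m i) (hξ0 : 0 < ξ 0)
    (hξ : StrictMono ξ) (hξ1 : ξ (Fin.last n) = 1) :
    (∀ z : ℂ, ∃! f : ℝ → ℂ, CubicString.IsIVPSolution (CubicString.pointMasses m ξ) z f) ∧
    ∀ φ : ℂ → ℝ → ℂ,
      (∀ z, CubicString.IsIVPSolution (CubicString.pointMasses m ξ) z (φ z)) →
      (∀ z, ∀ k ≤ 2, Tendsto (iteratedDeriv k (φ z)) (𝓝[>] 1)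
        (𝓝 (CubicString.endValue k (φ z)))) ∧
      ∃ y b : Fin (n + 1) → ℝ,
        StrictMono y ∧ (∀ i, 0 < y i) ∧
        Set.range (fun i => (y i : ℂ)) =
          CubicString.spectrumType2 (CubicString.pointMasses m ξ) ∧
        (∀ i, 0 < b i) ∧
        (∀ i, DifferentiableAt ℂ (fun z => CubicString.endValue 2 (φ z)) (y i)) ∧
        (∀ i, deriv (fun z => CubicString.endValue 2 (φ z)) (y i) ≠ 0) ∧
        (∀ i, (b i : ℂ) = -CubicString.endValue 1 (φ (y i)) /
          deriv (fun z => CubicString.endValue 2 (φ z)) (y i)) ∧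
        ∀ z ∉ CubicString.spectrumType2 (CubicString.pointMasses m ξ),
          CubicString.endValue 2 (φ z) ≠ 0 ∧
          (Integrable (fun t : ℝ => 1 / (z - (t : ℂ))) (CubicString.pointMasses b y) ∧
            CubicString.weylW φ z =
              ∫ t : ℝ, 1 / (z - (t : ℂ)) ∂(CubicString.pointMasses b y)) ∧
          (Integrable (fun p : ℝ × ℝ => 1 / ((z - (p.2 : ℂ)) * ((p.1 : ℂ) + (p.2 : ℂ))))
              ((CubicString.pointMasses b y).prod (CubicString.pointMasses b y)) ∧
            CubicString.weylZ φ z =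
              ∫ p : ℝ × ℝ, 1 / ((z - (p.2 : ℂ)) * ((p.1 : ℂ) + (p.2 : ℂ)))
                ∂((CubicString.pointMasses b y).prod (CubicString.pointMasses b y))) := by

  have hp0 : ∀ i, 0 < ξ i := fun i => hξ0.trans_le (hξ.monotone (Fin.zero_le i))
  refine ⟨CubicString.existsUnique_isIVPSolution hm hp0 hξ, fun φ hφ => ?_⟩
  obtain ⟨y, e, h⟩ := CubicString.exists_isStieltjes_stringPoly hm hp0 hξ
  set A := (CubicString.stringPoly m ξ (n + 1)).1
  set B := (CubicString.stringPoly m ξ (n + 1)).2.1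
  set D := (CubicString.stringPoly m ξ (n + 1)).2.2 with hD
  have hlim := fun z => CubicString.tendsto_end hξ ((CubicString.isIVPSolution_iff hm hp0).1 (hφ z))
  simp only [hξ1, one_mul] at hlim
  have e0 : ∀ z, CubicString.endValue 0 (φ z) = Polynomial.aeval z A := fun z =>
    rightLim_eq_of_tendsto (hlim z).1
  have e1 : ∀ z, CubicString.endValue 1 (φ z) = Polynomial.aeval z B := fun z =>
    rightLim_eq_of_tendsto (hlim z).2.1
  have e2 : ∀ z, CubicString.endValue 2 (φ z) = Polynomial.aeval z D := fun z =>
    rightLim_eq_of_tendsto (hlim z).2.2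
  have hspec := CubicString.spectrumType2_eq hm hp0 hξ hξ1
  rw [← hD] at hspec
  have hev : ∀ (Q : Polynomial ℝ) (x : ℝ), Polynomial.aeval (x : ℂ) Q = ((Q.eval x : ℝ) : ℂ) :=
    fun Q x => Polynomial.aeval_algebraMap_apply_eq_algebraMap_eval x Q
  have hbpos : ∀ i : Fin (n + 1), 0 < CubicString.weight B D y i := fun i => h.weight_pos i.2
  refine ⟨fun z k hk => ?_, fun i => y i, fun i => CubicString.weight B D y i,
    fun i j hij => h.lt i j hij j.2, fun i => h.pos i i.2, ?_, hbpos, ?_, ?_, ?_, ?_⟩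
  · interval_cases k
    · rw [e0]; exact (hlim z).1
    · rw [e1]; exact (hlim z).2.1
    · rw [e2]; exact (hlim z).2.2
  · rw [hspec]
    ext z
    rw [Set.mem_ofPred_eq, h.aeval_eq_zero_iff]
    constructor
    · rintro ⟨i, rfl⟩
      exact ⟨i, i.2, rfl⟩
    · rintro ⟨i, hi, rfl⟩
      exact ⟨⟨i, hi⟩, rfl⟩
  · intro i
    simp only [e2]
    exact D.differentiable_aeval _
  · intro i
    simp only [e2]
    rw [Polynomial.deriv_aeval, hev]
    intro h0
    have h1 := h.deriv_sign i.2
    rw [Complex.ofReal_eq_zero.1 h0, mul_zero] at h1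
    exact lt_irrefl _ h1
  · intro i
    simp only [e2]
    rw [Polynomial.deriv_aeval, hev, e1, hev, CubicString.weight]
    push_cast
    rfl
  · intro z hz
    rw [hspec, Set.mem_ofPred_eq] at hz
    refine ⟨by rwa [e2], ⟨CubicString.integrable_pointMasses _, ?_⟩,
      CubicString.integrable_pointMasses_prod _, ?_⟩
    · rw [CubicString.weylW, e1, e2, h.weyl_snd hz, CubicString.integral_pointMasses hbpos,
        ← Fin.sum_univ_eq_sum_range (fun i => (CubicString.weight B D y i : ℂ) * (1 / (z - y i)))]
    · rw [CubicString.weylZ, e0, e2, h.weyl_fst hz, CubicString.integral_pointMasses_prod hbpos,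
        ← Fin.sum_univ_eq_sum_range (fun i => ∑ j ∈ Finset.range (n + 1),
          (CubicString.weight B D y i : ℂ) * CubicString.weight B D y j *
            (1 / ((z - y j) * (y i + y j))))]
      refine Finset.sum_congr rfl fun i _ => ?_
      rw [← Fin.sum_univ_eq_sum_range (fun j => (CubicString.weight B D y i : ℂ) *
        CubicString.weight B D y j * (1 / ((z - y j) * (y i + y j))))]
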